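/- For $k\ge 1$ and $n\ge 0$ let $L_k(n)$ be the number of $k\times n$ Latin rectangles (matrices with entries in $\{1,\dots,n\}$ in which no row and no column contains a repeated entry), and let $R_k(n)$ be the number of those that are reduced, i.e. whose first row is $1,2,\dots,n$. Then $L_k(n)=n!\,R_k(n)$. A room is a triple $(i,j,l)$ with $1\le i\le k$ and $1\le j,l\le n$; shafts, corridors and halls are the lines of rooms along which $l$, $i$, $j$ varies, respectively. A reduced lonely-hall configuration is a set of rooms that has exactly one room on each shaft and at most one room on each corridor, and that contains $(1,j,j)$ for every $j$. For a set $S$ of halls $(i,l)$ with $i\ge2$ let $G(S)$ be the number of reduced lonely-hall configurations containing no room of any hall of $S$. For $\varepsilon\in\{0,1\}^{k-1}$, with coordinates indexed by the rows $2,\dots,k$, let $s_\varepsilon(S)$ be the number of $l$ such that, for all $i\ge 2$, $(i,l)\in S$ if and only if $\varepsilon_i=1$. Let $|\varepsilon|$ be the number of ones of $\varepsilon$, and let $\mathbf 1=(1,\dots,1)$. For a family $t=(t_\varepsilon)$ of integers and a set $B$ of rows $\geq 2$ put $$f_B(t)=\sum_{\varepsilon:\ \varepsilon_i=0\ \forall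 i\in B}t_\varepsilon,\qquad g_k(t)=\sum_{\pi}\mu(\hat 0,\pi)\prod_{B\in\pi}f_B(t),$$ where $\pi$ runs over the partitions of the $(k-1)$-set of rows $2,\dots,k$ and $\mu$ is the Möbius function of the lattice of these partitions, ordered by refinement with least element $\hat 0$ the finest partition. For a family $s=(s_\varepsilon)$ of nonnegative integers let $s^{(\varepsilon)}$ be the family obtained from $s$ by replacing $s_\varepsilon$ by $s_\varepsilon-1$ and then $s_{\mathbf 1}$ by $s_{\mathbf 1}+1$ (so $s^{(\mathbf 1)}=s$). Then, for all $k\ge1$ and $n\ge0$: 1. $R_k(n)=\sum_S(-1)^{|S|}G(S)$, where $S$ runs over all sets of halls $(i,l)$ with $i\ge2$; moreover $G(S)=\prod_\varepsilon g_k(s^{(\varepsilon)})^{s_\varepsilon}$ with $s=s(S)$; and for every such set $T$ of halls, $g_k(s(T))$ is the number of ways of choosing one hall in each of the rows $2,\dots,k$, on pairwise different floors $l$ and none belonging to $T$. 2. $$R_k(n)=\sum_{\sum_\varepsilon s_\varepsilon=n}(-1)^{\sum_\varepsilon|\varepsilon|s_\varepsilon}\,\frac{n!}{\prod_\varepsilon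 s_\varepsilon!}\,\prod_{\varepsilon}g_k\bigl(s^{(\varepsilon)}\bigr)^{s_\varepsilon},$$ the sum being over all families of $2^{k-1}$ nonnegative integers $s_\varepsilon$ with sum $n$. 3. For fixed $k$ and $n\to\infty$, the sum in 2 has on the order of $n^{2^{k-1}-1}$ terms. Suppose it is evaluated as written: the factorials as products $1\cdot2\cdots r$, $g_k$ by its defining formula with the values $\mu(\hat 0,\pi)$ as constants, powers by evaluating the base once and multiplying repeatedly, divisions counted as multiplications. Then each term takes a number of additions bounded in terms of $k$ alone and at least $n$ and at most $C_k(n+1)$ multiplications, and the whole expression takes on the order of $n^{2^{k-1}}$ additions and multiplications (upper and lower bounds up to constant factors depending only on $k$). 4. For $k=4$, writing the rows $2,3,4$ as $1,2,3$, $$g_4=f_1f_2f_3-f_{1,2}f_3-f_{2,3}f_1-f_{1,3}f_2+2f_{1,2,3},$$ where $f_1=t_{000}+t_{010}+t_{001}+t_{011}$, $f_{1,2}=t_{000}+t_{001}$, $f_{1,2,3}=t_{000}$, and symmetrically for $f_2,f_3,f_{2,3},f_{1,3}$; and the formula in 2 holds for $R_4(n)$ with this $g_4$. -/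

import Mathlib

open Finset Filter Asymptotics
open scoped Nat

namespace LatinRect

/-! ### Latin rectangles -/

/-- A `k × n` Latin rectangle with entries in an `n`-element set:
no row and no column contains a repeated entry. -/
def IsLatin {k n : ℕ} (A : Matrix (Fin k) (Fin n) (Fin n)) : Prop :=
  (∀ i, Function.Injective fun j => A i j) ∧ ∀ j, Function.Injective fun i => A i j

/-- A rectangle is reduced if its first row is in order. -/
def IsReduced {k n : ℕ} (A : Matrix (Fin k) (Fin n) (Fin n)) : Prop :=
  ∀ i : Fin k, i.val = 0 → ∀ j, A i j = j

/-- `L_k(n)`: the number of `k × n` Latin rectangles. -/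
noncomputable def latinCount (k n : ℕ) : ℕ :=
  Nat.card {A : Matrix (Fin k) (Fin n) (Fin n) // IsLatin A}

/-- `R_k(n)`: the number of reduced `k × n` Latin rectangles. -/
noncomputable def reducedCount (k n : ℕ) : ℕ :=
  Nat.card {A : Matrix (Fin k) (Fin n) (Fin n) // IsLatin A ∧ IsReduced A}

/-! ### Lonely-hall configurations

Throughout the rest, `m = k - 1` is the number of rows other than the first (back) one.  A room
is a triple `(i, j, l)` (row, column, floor); a room `(i, j, l)` of a Latin rectangle `A` is
selected when `A i j = l`.  Shafts, corridors and halls are the lines of rooms obtained by letting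
`l`, `i` and `j` vary, respectively. -/

/-- A selection of rooms with exactly one room on any shaft and at most one room on any corridor. -/
def IsLonelyHall {k n : ℕ} (X : Finset (Fin k × Fin n × Fin n)) : Prop :=
  (∀ i j, ∃! l, (i, j, l) ∈ X) ∧
    ∀ j l i i', (i, j, l) ∈ X → (i', j, l) ∈ X → i = i'

/-- The selection in the back halls (row `0`) is the standard one, `l = j`. -/
def IsReducedLonelyHall {m n : ℕ} (X : Finset (Fin (m + 1) × Fin n × Fin n)) : Prop :=
  IsLonelyHall X ∧ ∀ j, (0, j, j) ∈ X

/-- `G(S)`: the number of reduced lonely-hall configurations omitting every hall of `S`.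
The pair `(i, l)` in `S` stands for the hall of floor `l` in row `i + 1`; so `S` ranges over the
sets of halls that are not at the back. -/
noncomputable def omitCount {m n : ℕ} (S : Finset (Fin m × Fin n)) : ℕ :=
  Nat.card {X : Finset (Fin (m + 1) × Fin n × Fin n) //
    IsReducedLonelyHall X ∧ ∀ h ∈ S, ∀ j, (h.1.succ, j, h.2) ∉ X}

/-- The number of ways of picking one hall from each of the `m` rows that are not at the back,
all on different floors and none belonging to `T`. -/
noncomputable def pickCount {m n : ℕ} (T : Finset (Fin m × Fin n)) : ℕ :=
  Nat.card {c : Fin m → Fin n // Function.Injective c ∧ ∀ i, (i, c i) ∉ T}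

/-! ### Parameters -/

/-- The `2 ^ m` indices `ε = ε₁ ⋯ ε_m` with `ε_i ∈ {0, 1}`. -/
abbrev Idx (m : ℕ) : Type := Fin m → Fin 2

/-- `|ε|`, the number of ones in `ε`. -/
def weight {m : ℕ} (ε : Idx m) : ℕ := ∑ i, (ε i : ℕ)

/-- The parameter `s_ε` of a set `S` of halls: the number of floors `l` such that the halls of
floor `l` that belong to `S` are exactly those in the rows `i` with `ε_i = 1`. -/
noncomputable def param {m n : ℕ} (S : Finset (Fin m × Fin n)) (ε : Idx m) : ℕ :=
  Nat.card {l : Fin n // ∀ i, (i, l) ∈ S ↔ ε i = 1}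

/-- The parameters obtained from `s` by first decreasing `s_ε` by one and then increasing
`s_{1⋯1}` by one (nothing changes if `ε = 1⋯1`). -/
def shift {m : ℕ} (s : Idx m → ℕ) (ε : Idx m) : Idx m → ℤ := fun δ =>
  (s δ : ℤ) + (if δ = ε then -1 else 0) + (if δ = 1 then 1 else 0)

/-- The set of all `s = (s_ε)` of nonnegative integers with `∑ s_ε = n`. -/
noncomputable def paramSet (m n : ℕ) : Finset (Idx m → ℕ) := piAntidiag univ n

/-! ### The function `g_k` -/

/-- The partitions of an `m`-set, ordered by refinement (the finest partition is `⊥`). -/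
abbrev SetPartition (m : ℕ) : Type := Finpartition (univ : Finset (Fin m))

open Classical in
/-- The partition lattice is finite, hence locally finite. -/
noncomputable instance instLocallyFiniteOrderSetPartition (m : ℕ) :
    LocallyFiniteOrder (SetPartition m) := Fintype.toLocallyFiniteOrder

open Classical in
/-- The value `μ(⊥, π)` of the Möbius function of the lattice of partitions of an `m`-set. -/
noncomputable def moebius {m : ℕ} (π : SetPartition m) : ℤ := IncidenceAlgebra.mu ℤ ⊥ π

/-- `f_B = ∑ t_ε` over the `ε` that vanish on `B`. -/
def f {m : ℕ} (B : Finset (Fin m)) (t : Idx m → ℤ) : ℤ :=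
  ∑ ε : Idx m with ∀ i ∈ B, ε i = 0, t ε

/-- The function `g_k` for `k = m + 1`. -/
noncomputable def g (m : ℕ) (t : Idx m → ℤ) : ℤ :=
  ∑ π : SetPartition m, moebius π * ∏ B ∈ π.parts, f B t

/-- The term of the formula for `R_{m+1}(n)` that belongs to the parameters `s`, where `h` is the
function whose powers are multiplied. -/
def summand {m : ℕ} (h : (Idx m → ℤ) → ℤ) (s : Idx m → ℕ) : ℤ :=
  (-1) ^ (∑ ε, weight ε * s ε) * (Nat.multinomial univ s : ℤ) * ∏ ε, h (shift s ε) ^ s ε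

/-- The function `g_4`, written out. -/
def g4 (t : Idx 3 → ℤ) : ℤ :=
  let f₁ := t ![0, 0, 0] + t ![0, 1, 0] + t ![0, 0, 1] + t ![0, 1, 1]
  let f₂ := t ![0, 0, 0] + t ![1, 0, 0] + t ![0, 0, 1] + t ![1, 0, 1]
  let f₃ := t ![0, 0, 0] + t ![1, 0, 0] + t ![0, 1, 0] + t ![1, 1, 0]
  let f₁₂ := t ![0, 0, 0] + t ![0, 0, 1]
  let f₂₃ := t ![0, 0, 0] + t ![1, 0, 0]
  let f₁₃ := t ![0, 0, 0] + t ![0, 1, 0]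
  let f₁₂₃ := t ![0, 0, 0]
  f₁ * f₂ * f₃ - f₁₂ * f₃ - f₂₃ * f₁ - f₁₃ * f₂ + 2 * f₁₂₃

/-! ### Arithmetic expressions and the number of operations needed to evaluate them -/

/-- Arithmetic expressions over integer constants. -/
inductive ArithExpr : Type
  | lit (z : ℤ) : ArithExpr
  | add (a b : ArithExpr) : ArithExpr
  | mul (a b : ArithExpr) : ArithExpr
  | div (a b : ArithExpr) : ArithExpr
  | pow (a : ArithExpr) (r : ℕ) : ArithExpr

namespace ArithExpr

/-- The value of an expression. -/
def eval : ArithExpr → ℚ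
  | lit z => z
  | add a b => a.eval + b.eval
  | mul a b => a.eval * b.eval
  | div a b => a.eval / b.eval
  | pow a r => a.eval ^ r

/-- The number of additions performed in evaluating an expression. -/
def adds : ArithExpr → ℕ
  | lit _ => 0
  | add a b => a.adds + b.adds + 1
  | mul a b => a.adds + b.adds
  | div a b => a.adds + b.adds
  | pow a _ => a.adds

/-- The number of multiplications performed in evaluating an expression.  A division counts as a
multiplication; an `r`-th power is evaluated by computing its base once and multiplying
repeatedly, which takes `r - 1` multiplications (none for `r = 0`). -/
def muls : ArithExpr → ℕ
  | lit _ => 0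
  | add a b => a.muls + b.muls
  | mul a b => a.muls + b.muls + 1
  | div a b => a.muls + b.muls + 1
  | pow a r => a.muls + (r - 1)

/-- The number of additions and multiplications performed in evaluating an expression. -/
def cost (e : ArithExpr) : ℕ := e.adds + e.muls

/-- The sum of a list of expressions. -/
def sum (l : List ArithExpr) : ArithExpr := l.foldr add (lit 0)

/-- The product of a list of expressions. -/
def prod (l : List ArithExpr) : ArithExpr := l.foldr mul (lit 1)

end ArithExpr

/-- `r!` as the product of `1, …, r`. -/
def factExpr (r : ℕ) : ArithExpr := ArithExpr.prod ((List.range r).map fun i => .lit ((i : ℤ) + 1))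

/-- The multinomial coefficient `n! / ∏ s_ε!`. -/
noncomputable def multinomialExpr {m : ℕ} (n : ℕ) (s : Idx m → ℕ) : ArithExpr :=
  .div (factExpr n) (ArithExpr.prod ((univ : Finset (Idx m)).toList.map fun ε => factExpr (s ε)))

/-- The sign `(-1) ^ ∑ |ε| s_ε`. -/
noncomputable def signExpr {m : ℕ} (s : Idx m → ℕ) : ArithExpr :=
  ArithExpr.prod ((univ : Finset (Idx m)).toList.map fun ε => .pow (.lit ((-1) ^ weight ε)) (s ε))

/-- The shifted parameters. -/
def shiftExpr {m : ℕ} (s : Idx m → ℕ) (ε : Idx m) : Idx m → ArithExpr := fun δ =>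
  .add (.add (.lit (s δ)) (.lit (if δ = ε then -1 else 0))) (.lit (if δ = 1 then 1 else 0))

/-- `f_B` as an expression. -/
noncomputable def fExpr {m : ℕ} (B : Finset (Fin m)) (t : Idx m → ArithExpr) : ArithExpr :=
  ArithExpr.sum (({ε : Idx m | ∀ i ∈ B, ε i = 0} : Finset (Idx m)).toList.map t)

/-- `g_k` (`k = m + 1`) as an expression; the values of the Möbius function are constants that
depend on `m` only. -/
noncomputable def gExpr (m : ℕ) (t : Idx m → ArithExpr) : ArithExpr :=
  ArithExpr.sum ((univ : Finset (SetPartition m)).toList.map fun π =>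
    .mul (.lit (moebius π)) (ArithExpr.prod (π.parts.toList.map fun B => fExpr B t)))

/-- A term of the formula for `R_{m+1}(n)` as an expression. -/
noncomputable def termExpr (m n : ℕ) (s : Idx m → ℕ) : ArithExpr :=
  .mul (.mul (signExpr s) (multinomialExpr n s))
    (ArithExpr.prod ((univ : Finset (Idx m)).toList.map fun ε => .pow (gExpr m (shiftExpr s ε)) (s ε)))

/-- The formula for `R_{m+1}(n)` as an expression. -/
noncomputable def formulaExpr (m n : ℕ) : ArithExpr :=
  ArithExpr.sum ((paramSet m n).toList.map fun s => termExpr m n s)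

end LatinRect

open LatinRect

/-!
Below its first row, a reduced Latin rectangle is a family of columns, one for each `j`, in which
column `j` has no repeated entry and no entry `j`; a reduced lonely-hall configuration is a family
of columns without a condition on the rows, and a configuration comes from a Latin rectangle
exactly if it misses no hall. Inclusion-exclusion over the set `S` of missed halls
(`reducedCount_eq_sum_omitCount`) therefore gives `R` as an alternating sum of the numbers `G(S)`.

With no condition on the rows, the columns can be chosen independently
(`omitCount_eq_prod_pickCount`). Column `j` is an injective choice of floors that avoids `S` and
all halls of floor `j`; adding the latter to `S` moves floor `j` to the index `1⋯1`, which is the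
shift of the parameters (`param_union_floor`).

The number of injective choices avoiding a set `T` is found by Moebius inversion: the choices that
are constant on the blocks of a partition `π` are counted by `∏ f_B`, since each block picks its
floor freely (`prod_f_param`), and `∑ μ(⊥, π)` over the `π` below the kernel of a choice is `1` if
the choice is injective and `0` otherwise (`pickCount_eq_g`).

A set of halls amounts to a function from floors to indices `ε`, so a multinomial coefficient
counts the sets with given parameters (`card_filter_param_eq`), and grouping the alternating sum
by parameters gives the formula.

For the costs, the number of operations in evaluating `g` does not depend on its arguments, so
only the factorials and powers depend on `n`, and they take linearly many multiplications. The
number of terms is a binomial coefficient (`card_paramSet`).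
-/

namespace LatinRect

/-! ### Rectangles and configurations as families of columns -/

/-- Permuting the columns of a Latin rectangle puts its first row in order; the permutation and the
reduced rectangle determine the original one. -/
theorem latinCount_eq_factorial_mul (m n : ℕ) :
    latinCount (m + 1) n = n ! * reducedCount (m + 1) n := by
  have hP : Nat.card (Equiv.Perm (Fin n)) = n ! := by
    rw [Nat.card_perm, Nat.card_fin]
  rw [latinCount, reducedCount, ← hP, ← Nat.card_prod]
  have hbij : ∀ A : {A : Matrix (Fin (m + 1)) (Fin n) (Fin n) // IsLatin A},
      Function.Bijective fun j => A.1 0 j := fun A => Finite.injective_iff_bijective.1 (A.2.1 0)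
  let row : {A : Matrix (Fin (m + 1)) (Fin n) (Fin n) // IsLatin A} → Equiv.Perm (Fin n) :=
    fun A => Equiv.ofBijective _ (hbij A)
  have hrow : ∀ (A : {A : Matrix (Fin (m + 1)) (Fin n) (Fin n) // IsLatin A}) (j : Fin n),
      A.1 0 ((row A).symm j) = j := fun A j => (row A).apply_symm_apply j
  refine Nat.card_congr
    { toFun := fun A => (row A, ⟨fun i j => A.1 i ((row A).symm j), ⟨?_, ?_⟩, ?_⟩)
      invFun := fun p => ⟨fun i j => p.2.1 i (p.1 j), ?_, ?_⟩
      left_inv := ?_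
      right_inv := ?_ }
  · exact fun i => (A.2.1 i).comp (row A).symm.injective
  · exact fun j => A.2.2 _
  · intro i hi j
    obtain rfl : i = 0 := Fin.ext hi
    exact hrow A j
  · exact fun i => (p.2.2.1.1 i).comp p.1.injective
  · exact fun j => p.2.2.1.2 _
  · intro A
    ext i j : 3
    simp
  · rintro ⟨σ, A, hA, hr⟩
    have h : ∀ (h : IsLatin fun i j => A i (σ j)), row ⟨_, h⟩ = σ := by
      intro h
      ext j
      exact congrArg Fin.val (hr 0 rfl (σ j))
    ext1
    · exact h _
    · ext i j : 3
      have hl : IsLatin fun i j => A i (σ j) :=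
        ⟨fun i => (hA.1 i).comp σ.injective, fun j => hA.2 _⟩
      change (A i (σ ((row ⟨fun i j => A i (σ j), hl⟩).symm j))).val = _
      rw [h, Equiv.apply_symm_apply]

/-- A family of columns `c j`, each listing the floors of the rooms selected in rows `2, …, k`, such
that column `j`, headed by `j` itself, has no repeated entry. -/
def IsColumns {m n : ℕ} (c : Fin n → Fin m → Fin n) : Prop :=
  ∀ j, Function.Injective (c j) ∧ ∀ i, c j i ≠ j

theorem isColumns_iff_injective_cons {m n : ℕ} {c : Fin n → Fin m → Fin n} :
    IsColumns c ↔ ∀ j, Function.Injective (Fin.cons j (c j) : Fin (m + 1) → Fin n) := by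
  simp only [IsColumns, Fin.cons_injective_iff, Set.mem_range, not_exists, and_comm]

/-- Reduced Latin rectangles are the families of columns in which every row is onto. -/
theorem reducedCount_eq_card_columns (m n : ℕ) :
    reducedCount (m + 1) n = Nat.card {c : Fin n → Fin m → Fin n //
      IsColumns c ∧ ∀ h : Fin m × Fin n, ∃ j, c j h.1 = h.2} := by
  refine Nat.card_congr
    { toFun := fun A => ⟨fun j i => A.1 i.succ j, ?_, ?_⟩
      invFun := fun c => ⟨fun i j => (Fin.cons j (c.1 j) : Fin (m + 1) → Fin n) i, ⟨?_, ?_⟩, ?_⟩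
      left_inv := ?_
      right_inv := ?_ }
  · intro j
    refine ⟨(A.2.1.2 j).comp (Fin.succ_injective m), fun i h => ?_⟩
    rw [← A.2.2 0 rfl j] at h
    exact Fin.succ_ne_zero i (A.2.1.2 (A.1 0 j) (by simpa [A.2.2 0 rfl] using h))
  · exact fun h => Finite.surjective_of_injective (A.2.1.1 h.1.succ) h.2
  · intro i
    refine Fin.cases ?_ (fun i => ?_) i
    · exact fun _ _ h => by simpa using h
    · have : Function.Surjective fun j => c.1 j i := fun l => c.2.2 (i, l)
      simpa using Finite.injective_iff_surjective.2 this
  · exact isColumns_iff_injective_cons.1 c.2.1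
  · intro i hi j
    obtain rfl : i = 0 := Fin.ext hi
    simp
  · intro A
    ext i j : 3
    refine Fin.cases ?_ (fun i => ?_) i
    · simp [A.2.2 0 rfl j]
    · simp
  · intro c
    ext j i : 3
    simp

/-- Choosing the room on each shaft turns reduced lonely-hall configurations into families of
columns. -/
theorem omitCount_eq_card_columns {m n : ℕ} (S : Finset (Fin m × Fin n)) :
    omitCount S = Nat.card {c : Fin n → Fin m → Fin n //
      IsColumns c ∧ ∀ h ∈ S, ∀ j, c j h.1 ≠ h.2} := by
  classical
  let floor : {X : Finset (Fin (m + 1) × Fin n × Fin n) // IsReducedLonelyHall X ∧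
      ∀ h ∈ S, ∀ j, (h.1.succ, j, h.2) ∉ X} → Fin (m + 1) → Fin n → Fin n :=
    fun X i j => (X.2.1.1.1 i j).choose
  have hfloor : ∀ X i j l, (i, j, l) ∈ X.1 ↔ floor X i j = l := by
    intro X i j l
    have h := (X.2.1.1.1 i j).choose_spec
    exact ⟨fun hl => (h.2 l hl).symm, fun hl => hl ▸ h.1⟩
  refine Nat.card_congr
    { toFun := fun X => ⟨fun j i => floor X i.succ j, ?_, ?_⟩
      invFun := fun c => ⟨univ.filter fun r =>
        (Fin.cons r.2.1 (c.1 r.2.1) : Fin (m + 1) → Fin n) r.1 = r.2.2, ⟨⟨?_, ?_⟩, ?_⟩, ?_⟩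
      left_inv := ?_
      right_inv := ?_ }
  · have h0 : ∀ j, floor X 0 j = j := fun j => (hfloor X 0 j j).1 (X.2.1.2 j)
    have hinj : ∀ i i' j, floor X i j = floor X i' j → i = i' := fun i i' j h =>
      X.2.1.1.2 j _ i i' ((hfloor X _ _ _).2 h) ((hfloor X _ _ _).2 rfl)
    exact fun j => ⟨fun i i' h => Fin.succ_injective m (hinj _ _ j h),
      fun i h => Fin.succ_ne_zero i (hinj _ _ j (h.trans (h0 j).symm))⟩
  · exact fun h hS j hj => X.2.2 h hS j ((hfloor X _ _ _).2 hj)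
  · intro i j
    simp
  · intro j l i i' h h'
    simp only [mem_filter, mem_univ, true_and] at h h'
    exact isColumns_iff_injective_cons.1 c.2.1 j (h.trans h'.symm)
  · intro j
    simp
  · intro h hS j
    simpa using c.2.2 h hS j
  · intro X
    ext ⟨i, j, l⟩
    have h0 : floor X 0 j = j := (hfloor X 0 j j).1 (X.2.1.2 j)
    simp only [mem_filter, mem_univ, true_and, hfloor]
    refine Fin.cases ?_ (fun i => ?_) i
    · simp [h0]
    · simp
  · intro c
    ext j i : 3
    simp only
    rw [← hfloor]
    simp

/-- Inclusion-exclusion over the halls that a family of columns misses. -/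
theorem reducedCount_eq_sum_omitCount (m n : ℕ) :
    (reducedCount (m + 1) n : ℤ) =
      ∑ S : Finset (Fin m × Fin n), (-1) ^ S.card * (omitCount S : ℤ) := by
  classical
  have h := inclusion_exclusion_sum_inf_compl (univ : Finset (Fin m × Fin n))
    (fun h => univ.filter fun c : Fin n → Fin m → Fin n => ∀ j, c j h.1 ≠ h.2)
    (fun c => if IsColumns c then (1 : ℤ) else 0)
  rw [reducedCount_eq_card_columns]
  simp only [omitCount_eq_card_columns, Nat.card_eq_fintype_card, Fintype.card_subtype]
  simp only [sum_boole, smul_eq_mul, powerset_univ] at h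
  refine Eq.trans ?_ (h.trans (sum_congr rfl fun S _ => ?_))
  · refine congrArg (fun s => ((#s : ℕ) : ℤ)) (Finset.ext fun c => ?_)
    simp [mem_inf, and_comm]
  · refine congrArg (fun s => (-1) ^ #S * ((#s : ℕ) : ℤ)) (Finset.ext fun c => ?_)
    simp [mem_inf, and_comm]

/-! ### One column at a time -/

/-- The columns can be chosen independently: column `j` avoids `S` and all halls of floor `j`. -/
theorem omitCount_eq_prod_pickCount {m n : ℕ} (S : Finset (Fin m × Fin n)) :
    omitCount S = ∏ j, pickCount (S ∪ univ ×ˢ {j}) := by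
  classical
  rw [omitCount_eq_card_columns]
  simp only [pickCount]
  rw [← Nat.card_pi]
  have key : ∀ c : Fin n → Fin m → Fin n, (IsColumns c ∧ ∀ h ∈ S, ∀ j, c j h.1 ≠ h.2) ↔
      ∀ j, Function.Injective (c j) ∧ ∀ i, (i, c j i) ∉ S ∪ univ ×ˢ {j} := by
    intro c
    simp only [IsColumns, mem_union, mem_product, mem_univ, mem_singleton, true_and, not_or]
    constructor
    · exact fun h j => ⟨(h.1 j).1, fun i => ⟨fun hS => h.2 _ hS j rfl, (h.1 j).2 i⟩⟩
    · intro h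
      refine ⟨fun j => ⟨(h j).1, fun i => ((h j).2 i).2⟩, ?_⟩
      rintro ⟨i, l⟩ hS j hl
      exact ((h j).2 i).1 (by rwa [hl])
  exact Nat.card_congr
    { toFun := fun c j => ⟨c.1 j, (key c.1).1 c.2 j⟩
      invFun := fun c => ⟨fun j => (c j).1, (key _).2 fun j => (c j).2⟩
      left_inv := fun _ => rfl
      right_inv := fun _ => rfl }

/-- The index `ε` of floor `l`: `ε_i = 1` if and only if `S` contains the hall of floor `l` in row
`i`. -/
def floorType {m n : ℕ} (S : Finset (Fin m × Fin n)) (l : Fin n) : Idx m :=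
  fun i => if (i, l) ∈ S then 1 else 0

theorem floorType_eq_iff {m n : ℕ} {S : Finset (Fin m × Fin n)} {l : Fin n} {ε : Idx m} :
    floorType S l = ε ↔ ∀ i, (i, l) ∈ S ↔ ε i = 1 := by
  rw [funext_iff]
  refine forall_congr' fun i => ?_
  by_cases h : (i, l) ∈ S
  · simp [floorType, h, eq_comm]
  · simp only [floorType, h, if_false, false_iff]
    generalize ε i = x
    revert x
    decide

theorem param_eq_card_filter {m n : ℕ} (S : Finset (Fin m × Fin n)) (ε : Idx m) :
    param S ε = #{l | floorType S l = ε} := by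
  classical
  simp only [param, Nat.card_eq_fintype_card, Fintype.card_subtype, floorType_eq_iff]

theorem param_cast_eq_sum {m n : ℕ} (S : Finset (Fin m × Fin n)) (ε : Idx m) :
    (param S ε : ℤ) = ∑ l, if floorType S l = ε then 1 else 0 := by
  rw [param_eq_card_filter, card_filter]
  push_cast
  rfl

theorem floorType_union_floor {m n : ℕ} (S : Finset (Fin m × Fin n)) (j l : Fin n) :
    floorType (S ∪ univ ×ˢ {j}) l = if l = j then 1 else floorType S l := by
  ext i
  by_cases h : l = j <;> simp [floorType, h, eq_comm (a := j)]

/-- Adding to `S` all halls of floor `j` changes its parameters by the shift at the index of floor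
`j`. -/
theorem param_union_floor {m n : ℕ} (S : Finset (Fin m × Fin n)) (j : Fin n) :
    (fun ε => (param (S ∪ univ ×ˢ {j}) ε : ℤ)) = shift (param S) (floorType S j) := by
  funext δ
  simp only [shift, param_cast_eq_sum, floorType_union_floor]
  rw [← add_sum_erase _ _ (mem_univ j), ← add_sum_erase univ (fun l => if floorType S l = δ then
    (1 : ℤ) else 0) (mem_univ j)]
  have h : ∑ l ∈ univ.erase j, (if (if l = j then 1 else floorType S l) = δ then (1 : ℤ) else 0) =
      ∑ l ∈ univ.erase j, if floorType S l = δ then (1 : ℤ) else 0 :=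
    sum_congr rfl fun l hl => by rw [if_neg (ne_of_mem_erase hl)]
  rw [h]
  simp only [if_true, eq_comm (a := δ)]
  split_ifs <;> ring

theorem prod_floorType {m n : ℕ} (S : Finset (Fin m × Fin n)) (F : Idx m → ℤ) :
    ∏ j, F (floorType S j) = ∏ ε, F ε ^ param S ε := by
  simp only [param_eq_card_filter]
  rw [← prod_fiberwise_of_maps_to (t := univ) (g := floorType S) fun _ _ => mem_univ _]
  refine prod_congr rfl fun ε _ => prod_eq_pow_card fun j hj => ?_
  rw [(mem_filter.1 hj).2]

/-! ### Moebius inversion over the partitions of the rows -/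

open Classical in
theorem sum_moebius_filter_le {m : ℕ} (σ : SetPartition m) :
    ∑ π : SetPartition m with π ≤ σ, moebius π = if ⊥ = σ then 1 else 0 := by
  simp only [moebius]
  rw [← IncidenceAlgebra.sum_Icc_mu_right]
  refine sum_congr (Finset.ext fun π => ?_) fun _ _ => rfl
  simp

open Classical in
/-- The partition of the rows into the sets on which `c` is constant. -/
noncomputable def kerPartition {m n : ℕ} (c : Fin m → Fin n) : SetPartition m :=
  Finpartition.ofSetoid (Setoid.ker c)

theorem mem_part_kerPartition {m n : ℕ} {c : Fin m → Fin n} {i i' : Fin m} :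
    i' ∈ (kerPartition c).part i ↔ c i = c i' := by
  classical
  exact Finpartition.mem_part_ofSetoid_iff_rel

theorem le_kerPartition_iff {m n : ℕ} {c : Fin m → Fin n} {π : SetPartition m} :
    π ≤ kerPartition c ↔ ∀ B ∈ π.parts, ∀ i ∈ B, ∀ i' ∈ B, c i = c i' := by
  constructor
  · intro h B hB i hi i' hi'
    obtain ⟨D, hD, hBD⟩ := h hB
    rw [← mem_part_kerPartition, (kerPartition c).part_eq_of_mem hD (hBD hi)]
    exact hBD hi'
  · intro h B hB
    obtain ⟨i, hi⟩ := π.nonempty_of_mem_parts hB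
    exact ⟨_, (kerPartition c).part_mem.2 (mem_univ i),
      fun i' hi' => mem_part_kerPartition.2 (h B hB i hi i' hi')⟩

theorem kerPartition_eq_bot_iff {m n : ℕ} {c : Fin m → Fin n} :
    ⊥ = kerPartition c ↔ Function.Injective c := by
  rw [eq_comm, ← le_bot_iff]
  constructor
  · intro h i i' hc
    obtain ⟨D, hD, hsub⟩ := h ((kerPartition c).part_mem.2 (mem_univ i))
    obtain ⟨a, -, rfl⟩ := Finpartition.mem_bot_iff.1 hD
    have h1 := hsub (mem_part_kerPartition.2 rfl : i ∈ (kerPartition c).part i)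
    have h2 := hsub (mem_part_kerPartition.2 hc)
    rw [mem_singleton] at h1 h2
    exact h1.trans h2.symm
  · intro h B hB
    obtain ⟨i, hi⟩ := (kerPartition c).nonempty_of_mem_parts hB
    refine ⟨{i}, Finpartition.mem_bot_iff.2 ⟨i, mem_univ i, rfl⟩, fun i' hi' => ?_⟩
    rw [← (kerPartition c).part_eq_of_mem hB hi, mem_part_kerPartition] at hi'
    exact mem_singleton.2 (h hi').symm

/-- On the parameters of `T`, the function `f_B` counts the floors on which no hall in a row of `B`
belongs to `T`. -/
theorem f_param {m n : ℕ} (T : Finset (Fin m × Fin n)) (B : Finset (Fin m)) :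
    f B (fun ε => (param T ε : ℤ)) = (#{l : Fin n | ∀ i ∈ B, (i, l) ∉ T} : ℕ) := by
  simp only [f, param_cast_eq_sum]
  rw [sum_comm, card_filter]
  push_cast
  refine sum_congr rfl fun l _ => ?_
  rw [sum_ite_eq]
  refine if_congr ?_ rfl rfl
  simp [floorType]

/-- A choice of halls that is constant on the blocks of `π` is a choice of one floor per block. -/
theorem prod_f_param {m n : ℕ} (T : Finset (Fin m × Fin n)) (π : SetPartition m) :
    ∏ B ∈ π.parts, f B (fun ε => (param T ε : ℤ)) =
      Nat.card {c : Fin m → Fin n // (∀ i, (i, c i) ∉ T) ∧ π ≤ kerPartition c} := by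
  classical
  simp only [f_param]
  rw [← Nat.cast_prod, ← prod_coe_sort]
  have h : ∀ B : π.parts, #{l : Fin n | ∀ i ∈ B.1, (i, l) ∉ T} =
      Nat.card {l : Fin n // ∀ i ∈ B.1, (i, l) ∉ T} := fun B => by
    rw [Nat.card_eq_fintype_card, Fintype.card_subtype]
  rw [prod_congr rfl fun B _ => h B, ← Nat.card_pi]
  have hne : ∀ B : π.parts, ∃ i, i ∈ B.1 := fun B => π.nonempty_of_mem_parts B.2
  choose r hr using hne
  have hp : ∀ i, π.part i ∈ π.parts := fun i => π.part_mem.2 (mem_univ i)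
  congr 1
  refine Nat.card_congr
    { toFun := fun d => ⟨fun i => (d ⟨π.part i, hp i⟩).1, ?_, ?_⟩
      invFun := fun c B => ⟨c.1 (r B), ?_⟩
      left_inv := ?_
      right_inv := ?_ }
  · exact fun i => (d ⟨π.part i, hp i⟩).2 i (π.mem_part_self.2 (mem_univ i))
  · refine le_kerPartition_iff.2 fun B hB i hi i' hi' => ?_
    have : (⟨π.part i, hp i⟩ : π.parts) = ⟨π.part i', hp i'⟩ :=
      Subtype.ext ((π.part_eq_of_mem hB hi).trans (π.part_eq_of_mem hB hi').symm)
    exact congrArg (fun D => (d D).1) this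
  · intro i hi
    rw [le_kerPartition_iff.1 c.2.2 B.1 B.2 _ (hr B) i hi]
    exact c.2.1 i
  · intro d
    ext B : 2
    have : (⟨π.part (r B), hp _⟩ : π.parts) = B := Subtype.ext (π.part_eq_of_mem B.2 (hr B))
    exact congrArg (fun D => (d D).1) this
  · intro c
    ext i : 2
    exact le_kerPartition_iff.1 c.2.2 _ (hp i) _ (hr _) _ (π.mem_part_self.2 (mem_univ i))

/-- Sorting choices of halls by the partition on whose blocks they are constant, Moebius inversion
leaves exactly the injective ones. -/
theorem pickCount_eq_g {m n : ℕ} (T : Finset (Fin m × Fin n)) :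
    (pickCount T : ℤ) = g m (fun ε => (param T ε : ℤ)) := by
  classical
  have h : ∀ p : (Fin m → Fin n) → Prop,
      ((Nat.card {c : Fin m → Fin n // p c} : ℕ) : ℤ) = ∑ c, if p c then 1 else 0 := fun p => by
    rw [Nat.card_eq_fintype_card, Fintype.card_subtype, sum_boole]
  simp only [g, prod_f_param, pickCount, h, mul_sum]
  rw [sum_comm]
  refine sum_congr rfl fun c _ => ?_
  by_cases hc : ∀ i, (i, c i) ∉ T
  · have := sum_moebius_filter_le (kerPartition c)
    rw [sum_filter] at this
    simp only [hc, true_and, mul_ite, mul_one, mul_zero, this, kerPartition_eq_bot_iff,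
      implies_true, and_true, not_false_eq_true]
  · simp [hc]

theorem omitCount_eq_prod_g {m n : ℕ} (S : Finset (Fin m × Fin n)) :
    (omitCount S : ℤ) = ∏ ε, g m (shift (param S) ε) ^ param S ε := by
  rw [omitCount_eq_prod_pickCount, ← prod_floorType S fun ε => g m (shift (param S) ε)]
  push_cast
  exact prod_congr rfl fun j _ => by rw [pickCount_eq_g, param_union_floor]

/-! ### Grouping the sets of halls by their parameters -/

/-- The number of functions with prescribed sizes of the fibres is a multinomial coefficient. -/
theorem card_filter_card_fiber_eq {ι : Type*} [Fintype ι] [DecidableEq ι] {n : ℕ} {s : ι → ℕ}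
    (hs : s ∈ piAntidiag (univ : Finset ι) n) :
    #{F : Fin n → ι | ∀ ε, #{l | F l = ε} = s ε} = Nat.multinomial univ s := by
  classical
  -- compare the coefficients of `X ^ s` in the two expansions of `(∑ X_ε) ^ n`
  have hpow : ∀ t : ι → ℕ, ∏ ε, (MvPolynomial.X ε : MvPolynomial ι ℕ) ^ t ε =
      MvPolynomial.monomial (Finsupp.equivFunOnFinite.symm t) 1 := by
    intro t
    rw [MvPolynomial.monomial_eq, Finsupp.prod_fintype _ _ fun _ => pow_zero _]
    simp
  have h1 : (∑ ε, (MvPolynomial.X ε : MvPolynomial ι ℕ)) ^ n =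
      ∑ F : Fin n → ι, ∏ l, MvPolynomial.X (F l) := by
    rw [← Fintype.prod_sum]
    simp
  have h2 : ∀ F : Fin n → ι, ∏ l, (MvPolynomial.X (F l) : MvPolynomial ι ℕ) =
      ∏ ε, MvPolynomial.X ε ^ #{l | F l = ε} := by
    intro F
    rw [← prod_fiberwise_of_maps_to (t := univ) (g := F) fun _ _ => mem_univ _]
    refine prod_congr rfl fun ε _ => prod_eq_pow_card fun j hj => ?_
    rw [(mem_filter.1 hj).2]
  have h3 := h1.symm.trans (sum_pow_eq_sum_piAntidiag univ _ n)
  simp only [h2, hpow] at h3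
  have h4 := congrArg (MvPolynomial.coeff (Finsupp.equivFunOnFinite.symm s)) h3
  simp only [MvPolynomial.coeff_sum, MvPolynomial.coeff_monomial, ← nsmul_eq_mul,
    MvPolynomial.coeff_smul, EmbeddingLike.apply_eq_iff_eq] at h4
  simp only [smul_eq_mul, mul_ite, mul_one, mul_zero, sum_ite_eq', hs, if_true, sum_boole] at h4
  rw [← h4]
  simp [funext_iff]

/-- A set of halls is the same as the family of the indices of its floors. -/
def floorTypeEquiv (m n : ℕ) : Finset (Fin m × Fin n) ≃ (Fin n → Idx m) where
  toFun := floorType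
  invFun F := {h | F h.2 h.1 = 1}
  left_inv S := by ext h; simp [floorType]
  right_inv F := by
    funext l
    rw [floorType_eq_iff]
    simp

theorem sum_param {m n : ℕ} (S : Finset (Fin m × Fin n)) : ∑ ε, param S ε = n := by
  simp only [param_eq_card_filter]
  rw [← card_eq_sum_card_fiberwise fun _ _ => mem_univ _, card_univ, Fintype.card_fin]

theorem card_filter_param_eq {m n : ℕ} {s : Idx m → ℕ} (hs : s ∈ paramSet m n) :
    #{S : Finset (Fin m × Fin n) | param S = s} = Nat.multinomial univ s := by
  rw [← card_filter_card_fiber_eq hs]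
  refine card_equiv (floorTypeEquiv m n) fun S => ?_
  simp [funext_iff, param_eq_card_filter, floorTypeEquiv]

theorem card_eq_sum_weight_mul_param {m n : ℕ} (S : Finset (Fin m × Fin n)) :
    #S = ∑ ε, weight ε * param S ε := by
  have h1 : #S = ∑ l, weight (floorType S l) := by
    have : #S = ∑ h : Fin m × Fin n, if h ∈ S then 1 else 0 := by simp
    rw [this, Fintype.sum_prod_type_right]
    refine sum_congr rfl fun l _ => sum_congr rfl fun i _ => ?_
    simp only [floorType]
    split_ifs <;> rfl
  rw [h1, ← sum_fiberwise_of_maps_to (t := univ) (g := floorType S) fun _ _ => mem_univ _]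
  refine sum_congr rfl fun ε _ => ?_
  rw [sum_congr rfl fun l hl => by rw [(mem_filter.1 hl).2], sum_const, param_eq_card_filter,
    smul_eq_mul, mul_comm]

theorem reducedCount_eq_sum_summand (m n : ℕ) :
    (reducedCount (m + 1) n : ℤ) = ∑ s ∈ paramSet m n, summand (g m) s := by
  rw [reducedCount_eq_sum_omitCount]
  rw [← sum_fiberwise_of_maps_to (t := paramSet m n) (g := param) fun S _ => by
    simp [paramSet, sum_param]]
  refine sum_congr rfl fun s hs => ?_
  have h : ∀ S ∈ ({S | param S = s} : Finset (Finset (Fin m × Fin n))),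
      (-1) ^ #S * (omitCount S : ℤ) =
        (-1) ^ (∑ ε, weight ε * s ε) * ∏ ε, g m (shift s ε) ^ s ε := by
    intro S hS
    rw [card_eq_sum_weight_mul_param, omitCount_eq_prod_g, (mem_filter.1 hS).2]
  rw [sum_congr rfl h, sum_const, card_filter_param_eq hs, summand, nsmul_eq_mul]
  ring

/-! ### Values and costs of the arithmetic expressions -/

namespace ArithExpr

theorem eval_sum (l : List ArithExpr) : (sum l).eval = (l.map eval).sum := by
  induction l with
  | nil => simp [sum, eval]
  | cons a l ih => simpa [sum, eval] using ih

theorem eval_prod (l : List ArithExpr) : (prod l).eval = (l.map eval).prod := by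
  induction l with
  | nil => simp [prod, eval]
  | cons a l ih =>
    rw [List.map_cons, List.prod_cons, ← ih]
    rfl

theorem adds_sum (l : List ArithExpr) : (sum l).adds = (l.map adds).sum + l.length := by
  induction l with
  | nil => simp [sum, adds]
  | cons a l ih => simp [sum, adds] at ih ⊢; omega

theorem muls_sum (l : List ArithExpr) : (sum l).muls = (l.map muls).sum := by
  induction l with
  | nil => simp [sum, muls]
  | cons a l ih => simp [sum, muls] at ih ⊢; omega

theorem adds_prod (l : List ArithExpr) : (prod l).adds = (l.map adds).sum := by
  induction l with
  | nil => simp [prod, adds]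
  | cons a l ih => simp [prod, adds] at ih ⊢; omega

theorem muls_prod (l : List ArithExpr) : (prod l).muls = (l.map muls).sum + l.length := by
  induction l with
  | nil => simp [prod, muls]
  | cons a l ih => simp [prod, muls] at ih ⊢; omega

variable {ι : Type*} (s : Finset ι) (F : ι → ArithExpr)

theorem eval_sum_toList : (sum (s.toList.map F)).eval = ∑ i ∈ s, (F i).eval := by
  rw [eval_sum, List.map_map, sum_map_toList]
  rfl

theorem eval_prod_toList : (prod (s.toList.map F)).eval = ∏ i ∈ s, (F i).eval := by
  rw [eval_prod, List.map_map, prod_map_toList]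
  rfl

theorem adds_sum_toList : (sum (s.toList.map F)).adds = ∑ i ∈ s, (F i).adds + #s := by
  rw [adds_sum, List.map_map, sum_map_toList, List.length_map, length_toList]
  rfl

theorem muls_sum_toList : (sum (s.toList.map F)).muls = ∑ i ∈ s, (F i).muls := by
  rw [muls_sum, List.map_map, sum_map_toList]
  rfl

theorem adds_prod_toList : (prod (s.toList.map F)).adds = ∑ i ∈ s, (F i).adds := by
  rw [adds_prod, List.map_map, sum_map_toList]
  rfl

theorem muls_prod_toList : (prod (s.toList.map F)).muls = ∑ i ∈ s, (F i).muls + #s := by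
  rw [muls_prod, List.map_map, sum_map_toList, List.length_map, length_toList]
  rfl

end ArithExpr

open ArithExpr

/-- In the definition of `factExpr` the list of natural numbers is coerced to a list of integers; here
its members are coerced instead. -/
theorem factExpr_eq_prod_map (r : ℕ) :
    factExpr r = ArithExpr.prod ((List.range r).map fun i : ℕ => .lit ((i : ℤ) + 1)) := by
  simp [factExpr, Function.comp_def, ← List.map_eq_flatMap]

theorem eval_factExpr (r : ℕ) : (factExpr r).eval = (r ! : ℚ) := by
  rw [factExpr_eq_prod_map, eval_prod, List.map_map]
  induction r with
  | zero => simp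
  | succ r ih =>
    rw [List.range_succ, List.map_append, List.prod_append, ih, Nat.factorial_succ]
    simp [eval, mul_comm]

theorem adds_factExpr (r : ℕ) : (factExpr r).adds = 0 := by
  rw [factExpr_eq_prod_map, adds_prod, List.map_map]
  exact List.sum_eq_zero (by simp [adds])

theorem muls_factExpr (r : ℕ) : (factExpr r).muls = r := by
  rw [factExpr_eq_prod_map, muls_prod, List.map_map, List.length_map, List.length_range,
    List.sum_eq_zero (by simp [muls]), zero_add]

theorem eval_multinomialExpr {m n : ℕ} {s : Idx m → ℕ} (hs : s ∈ paramSet m n) :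
    (multinomialExpr n s).eval = (Nat.multinomial univ s : ℚ) := by
  have hn : ∑ ε, s ε = n := (mem_piAntidiag.1 hs).1
  have h := Nat.multinomial_spec univ s
  rw [hn] at h
  simp only [multinomialExpr, eval, eval_prod_toList, eval_factExpr]
  rw [← h, Nat.cast_mul, Nat.cast_prod, mul_div_cancel_left₀]
  exact prod_ne_zero_iff.2 fun ε _ => Nat.cast_ne_zero.2 (Nat.factorial_ne_zero _)

theorem eval_signExpr {m : ℕ} (s : Idx m → ℕ) :
    (signExpr s).eval = (-1) ^ ∑ ε, weight ε * s ε := by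
  simp [signExpr, eval_prod_toList, eval, prod_pow_eq_pow_sum, ← pow_mul]

theorem eval_shiftExpr {m : ℕ} (s : Idx m → ℕ) (ε δ : Idx m) :
    (shiftExpr s ε δ).eval = (shift s ε δ : ℚ) := by
  simp [shiftExpr, eval, shift]

theorem eval_gExpr {m : ℕ} {t : Idx m → ArithExpr} {u : Idx m → ℤ}
    (h : ∀ δ, (t δ).eval = (u δ : ℚ)) : (gExpr m t).eval = (g m u : ℚ) := by
  simp [gExpr, fExpr, g, f, eval_sum_toList, eval_prod_toList, eval, h]

theorem eval_termExpr {m n : ℕ} {s : Idx m → ℕ} (hs : s ∈ paramSet m n) :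
    (termExpr m n s).eval = (summand (g m) s : ℚ) := by
  simp [termExpr, summand, eval, eval_signExpr, eval_multinomialExpr hs, eval_prod_toList,
    eval_gExpr (eval_shiftExpr s _)]

theorem eval_formulaExpr (m n : ℕ) : (formulaExpr m n).eval = (reducedCount (m + 1) n : ℚ) := by
  rw [formulaExpr, eval_sum_toList, sum_congr rfl fun s hs => eval_termExpr hs]
  exact_mod_cast (reducedCount_eq_sum_summand m n).symm

/-- The numbers of operations in evaluating `g` do not depend on the values of its arguments. -/
theorem adds_gExpr_congr {m : ℕ} {t u : Idx m → ArithExpr} (h : ∀ δ, (t δ).adds = (u δ).adds) :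
    (gExpr m t).adds = (gExpr m u).adds := by
  simp [gExpr, fExpr, adds_sum_toList, adds_prod_toList, adds, h]

theorem muls_gExpr_congr {m : ℕ} {t u : Idx m → ArithExpr} (h : ∀ δ, (t δ).muls = (u δ).muls) :
    (gExpr m t).muls = (gExpr m u).muls := by
  simp [gExpr, fExpr, muls_sum_toList, muls_prod_toList, muls, h]

theorem adds_gExpr_shiftExpr {m : ℕ} (s : Idx m → ℕ) (ε : Idx m) :
    (gExpr m (shiftExpr s ε)).adds = (gExpr m (shiftExpr 0 (0 : Idx m))).adds :=
  adds_gExpr_congr fun _ => by simp [shiftExpr, adds]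

theorem muls_gExpr_shiftExpr {m : ℕ} (s : Idx m → ℕ) (ε : Idx m) :
    (gExpr m (shiftExpr s ε)).muls = (gExpr m (shiftExpr 0 (0 : Idx m))).muls :=
  muls_gExpr_congr fun _ => by simp [shiftExpr, muls]

theorem adds_termExpr (m n : ℕ) (s : Idx m → ℕ) :
    (termExpr m n s).adds = 2 ^ m * (gExpr m (shiftExpr 0 (0 : Idx m))).adds := by
  simp [termExpr, signExpr, multinomialExpr, adds, adds_prod_toList, adds_factExpr,
    adds_gExpr_shiftExpr]

theorem muls_termExpr (m n : ℕ) (s : Idx m → ℕ) :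
    (termExpr m n s).muls = 2 * ∑ ε, (s ε - 1) + n + ∑ ε, s ε +
      2 ^ m * ((gExpr m (shiftExpr 0 (0 : Idx m))).muls + 3) + 3 := by
  simp only [termExpr, signExpr, multinomialExpr, muls, muls_prod_toList, muls_factExpr,
    muls_gExpr_shiftExpr, sum_add_distrib, card_univ, Fintype.card_pi_const, Fintype.card_fin,
    sum_const, smul_eq_mul]
  ring

theorem exists_adds_muls_termExpr_bound (m : ℕ) : ∃ C : ℕ, ∀ n : ℕ, ∀ s ∈ paramSet m n,
    (termExpr m n s).adds ≤ C ∧ n ≤ (termExpr m n s).muls ∧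
      (termExpr m n s).muls ≤ C * (n + 1) := by
  set a := 2 ^ m * (gExpr m (shiftExpr 0 (0 : Idx m))).adds with ha
  set b := 2 ^ m * ((gExpr m (shiftExpr 0 (0 : Idx m))).muls + 3) with hb
  refine ⟨a + b + 4, fun n s hs => ?_⟩
  have hn : ∑ ε, s ε = n := (mem_piAntidiag.1 hs).1
  have h1 : ∑ ε, (s ε - 1) ≤ n := hn ▸ sum_le_sum fun ε _ => Nat.sub_le _ _
  rw [adds_termExpr, muls_termExpr, ← ha, ← hb, hn]
  refine ⟨by omega, by omega, ?_⟩
  nlinarith [Nat.zero_le (a * n), Nat.zero_le (b * n)]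

/-! ### Orders of magnitude -/

/-- The families of `2 ^ m` nonnegative integers with sum `n` are the multisets of `n` indices. -/
theorem card_paramSet (m n : ℕ) :
    #(paramSet m n) = (n + (2 ^ m - 1)).choose (2 ^ m - 1) := by
  have h : #(paramSet m n) = #((univ : Finset (Idx m)).sym n) := by
    rw [paramSet, ← map_sym_eq_piAntidiag, card_map]
  have hpos : 1 ≤ 2 ^ m := Nat.one_le_two_pow
  rw [h, sym_univ, card_univ, Sym.card_sym_eq_choose, Fintype.card_pi_const, Fintype.card_fin,
    show 2 ^ m + n - 1 = n + (2 ^ m - 1) by omega]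
  exact Nat.choose_symm_add

theorem isTheta_card_paramSet (m : ℕ) :
    (fun n : ℕ => ((paramSet m n).card : ℝ)) =Θ[atTop] fun n : ℕ => (n : ℝ) ^ (2 ^ m - 1) := by
  simp only [card_paramSet]
  generalize 2 ^ m - 1 = r
  refine IsTheta.trans ⟨(isTheta_choose r).1.comp_tendsto (tendsto_add_atTop_nat r),
    (isTheta_choose r).2.comp_tendsto (tendsto_add_atTop_nat r)⟩ ?_
  refine IsTheta.pow ?_ r
  have h := (IsEquivalent.refl (u := fun n : ℕ => (n : ℝ)) (l := atTop)).add_isLittleO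
    (isLittleO_const_left.2 <| Or.inr <| tendsto_norm_atTop_atTop.comp tendsto_natCast_atTop_atTop :
      (fun _ : ℕ => (r : ℝ)) =o[atTop] fun n : ℕ => (n : ℝ))
  have he : (fun n : ℕ => ((n + r : ℕ) : ℝ)) = (fun n : ℕ => (n : ℝ)) + fun _ => (r : ℝ) := by
    funext n
    simp
  exact he ▸ h.isTheta

theorem isTheta_cost_formulaExpr (m : ℕ) :
    (fun n : ℕ => ((formulaExpr m n).cost : ℝ)) =Θ[atTop] fun n : ℕ => (n : ℝ) ^ (2 ^ m) := by
  obtain ⟨C, hC⟩ := exists_adds_muls_termExpr_bound m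
  have hcost : ∀ n, (formulaExpr m n).cost =
      ∑ s ∈ paramSet m n, ((termExpr m n s).adds + (termExpr m n s).muls + 1) := by
    intro n
    rw [cost, formulaExpr, adds_sum_toList, muls_sum_toList, sum_add_distrib, sum_add_distrib,
      sum_const, smul_eq_mul, mul_one]
    omega
  have hlow : ∀ n, #(paramSet m n) * n ≤ (formulaExpr m n).cost := by
    intro n
    rw [hcost, ← smul_eq_mul]
    refine card_nsmul_le_sum _ _ _ fun s hs => ?_
    have := hC n s hs
    omega
  have hup : ∀ n, 1 ≤ n → (formulaExpr m n).cost ≤ (3 * C + 1) * (#(paramSet m n) * n) := by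
    intro n hn
    rw [hcost, mul_left_comm, ← smul_eq_mul]
    refine sum_le_card_nsmul _ _ _ fun s hs => ?_
    obtain ⟨h1, -, h2⟩ := hC n s hs
    nlinarith [Nat.mul_le_mul_left C hn]
  have hmul : (fun n : ℕ => ((#(paramSet m n) * n : ℕ) : ℝ)) =Θ[atTop]
      fun n : ℕ => (n : ℝ) ^ (2 ^ m) := by
    have h := (isTheta_card_paramSet m).mul (isTheta_refl (fun n : ℕ => (n : ℝ)) atTop)
    simp only [← pow_succ, Nat.sub_add_cancel Nat.one_le_two_pow] at h
    simpa using h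
  refine IsTheta.trans ⟨?_, ?_⟩ hmul
  · refine IsBigO.of_bound (3 * C + 1) ?_
    filter_upwards [eventually_ge_atTop 1] with n hn
    rw [Real.norm_natCast, Real.norm_natCast]
    exact_mod_cast hup n hn
  · refine IsBigO.of_bound 1 (Eventually.of_forall fun n => ?_)
    rw [Real.norm_natCast, Real.norm_natCast, one_mul]
    exact_mod_cast hlow n

/-! ### Three rows besides the first -/

set_option maxRecDepth 100000 in
theorem parts_setPartition_three (π : SetPartition 3) :
    π.parts = {{0}, {1}, {2}} ∨ π.parts = {{0, 1}, {2}} ∨ π.parts = {{1, 2}, {0}} ∨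
      π.parts = {{0, 2}, {1}} ∨ π.parts = {{0, 1, 2}} := by
  have h : ∀ p : Finset (Finset (Fin 3)), p.SupIndep id → p.sup id = univ → ⊥ ∉ p →
      p = {{0}, {1}, {2}} ∨ p = {{0, 1}, {2}} ∨ p = {{1, 2}, {0}} ∨
        p = {{0, 2}, {1}} ∨ p = {{0, 1, 2}} := by decide
  exact h _ π.supIndep π.sup_parts π.bot_notMem

open Classical in
theorem moebius_bot {m : ℕ} : moebius (⊥ : SetPartition m) = 1 := by
  rw [moebius, IncidenceAlgebra.mu_self]

theorem g_three_eq_g4 (t : Idx 3 → ℤ) : g 3 t = g4 t := by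
  let p0 : SetPartition 3 := ⟨{{0}, {1}, {2}}, by decide, by decide, by decide⟩
  let p1 : SetPartition 3 := ⟨{{0, 1}, {2}}, by decide, by decide, by decide⟩
  let p2 : SetPartition 3 := ⟨{{1, 2}, {0}}, by decide, by decide, by decide⟩
  let p3 : SetPartition 3 := ⟨{{0, 2}, {1}}, by decide, by decide, by decide⟩
  let p4 : SetPartition 3 := ⟨{{0, 1, 2}}, by decide, by decide, by decide⟩
  have huniv : (univ : Finset (SetPartition 3)) = {p0, p1, p2, p3, p4} := by
    ext π
    simp only [mem_univ, mem_insert, mem_singleton, true_iff, Finpartition.ext_iff]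
    exact parts_setPartition_three π
  -- the definition of refinement, in a form that is decidable
  have hle : ∀ π σ : SetPartition 3, π ≤ σ ↔ ∀ b ∈ π.parts, ∃ c ∈ σ.parts, b ⊆ c :=
    fun _ _ => Iff.rfl
  have hsum : ∀ F : SetPartition 3 → ℤ, ∑ π, F π = F p0 + F p1 + F p2 + F p3 + F p4 := by
    intro F
    rw [huniv, sum_insert (by decide), sum_insert (by decide), sum_insert (by decide),
      sum_insert (by decide), sum_singleton]
    ring
  have hbot : (⊥ : SetPartition 3) = p0 := by decide
  have h0 : moebius p0 = 1 := hbot ▸ moebius_bot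
  -- the other values follow: over the partitions that refine a given one `≠ ⊥` they add up to `0`
  have h1 : moebius p1 = -1 := by
    have h := sum_moebius_filter_le p1
    rw [hbot, sum_filter, hsum, if_pos ((hle p0 p1).2 (by decide)),
      if_pos le_rfl, if_neg (mt (hle p2 p1).1 (by decide)),
      if_neg (mt (hle p3 p1).1 (by decide)), if_neg (mt (hle p4 p1).1 (by decide)),
      if_neg (by decide)] at h
    omega
  have h2 : moebius p2 = -1 := by
    have h := sum_moebius_filter_le p2
    rw [hbot, sum_filter, hsum, if_pos ((hle p0 p2).2 (by decide)),
      if_neg (mt (hle p1 p2).1 (by decide)), if_pos le_rfl,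
      if_neg (mt (hle p3 p2).1 (by decide)), if_neg (mt (hle p4 p2).1 (by decide)),
      if_neg (by decide)] at h
    omega
  have h3 : moebius p3 = -1 := by
    have h := sum_moebius_filter_le p3
    rw [hbot, sum_filter, hsum, if_pos ((hle p0 p3).2 (by decide)),
      if_neg (mt (hle p1 p3).1 (by decide)), if_neg (mt (hle p2 p3).1 (by decide)),
      if_pos le_rfl, if_neg (mt (hle p4 p3).1 (by decide)),
      if_neg (by decide)] at h
    omega
  have h4 : moebius p4 = 2 := by
    have h := sum_moebius_filter_le p4
    rw [hbot, sum_filter, hsum, if_pos ((hle p0 p4).2 (by decide)),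
      if_pos ((hle p1 p4).2 (by decide)), if_pos ((hle p2 p4).2 (by decide)),
      if_pos ((hle p3 p4).2 (by decide)), if_pos le_rfl, if_neg (by decide)] at h
    omega
  have hf : ∀ (B : Finset (Fin 3)) (A : Finset (Idx 3)),
      (univ.filter fun ε : Idx 3 => ∀ i ∈ B, ε i = 0) = A → f B t = ∑ ε ∈ A, t ε :=
    fun B A h => by rw [f, h]
  have f0 := hf {0} {![0, 0, 0], ![0, 1, 0], ![0, 0, 1], ![0, 1, 1]} (by decide)
  have f1 := hf {1} {![0, 0, 0], ![1, 0, 0], ![0, 0, 1], ![1, 0, 1]} (by decide)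
  have f2 := hf {2} {![0, 0, 0], ![1, 0, 0], ![0, 1, 0], ![1, 1, 0]} (by decide)
  have f01 := hf {0, 1} {![0, 0, 0], ![0, 0, 1]} (by decide)
  have f12 := hf {1, 2} {![0, 0, 0], ![1, 0, 0]} (by decide)
  have f02 := hf {0, 2} {![0, 0, 0], ![0, 1, 0]} (by decide)
  have f012 := hf {0, 1, 2} {![0, 0, 0]} (by decide)
  have e0 : ∏ B ∈ p0.parts, f B t = f {0} t * (f {1} t * f {2} t) := by
    rw [prod_insert (by decide), prod_insert (by decide), prod_singleton]
  have e1 : ∏ B ∈ p1.parts, f B t = f {0, 1} t * f {2} t := by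
    rw [prod_insert (by decide), prod_singleton]
  have e2 : ∏ B ∈ p2.parts, f B t = f {1, 2} t * f {0} t := by
    rw [prod_insert (by decide), prod_singleton]
  have e3 : ∏ B ∈ p3.parts, f B t = f {0, 2} t * f {1} t := by
    rw [prod_insert (by decide), prod_singleton]
  have e4 : ∏ B ∈ p4.parts, f B t = f {0, 1, 2} t := prod_singleton _ _
  have four : ∀ a b c d : Idx 3, a ∉ ({b, c, d} : Finset _) → b ∉ ({c, d} : Finset _) →
      c ∉ ({d} : Finset _) → ∑ ε ∈ {a, b, c, d}, t ε = t a + t b + t c + t d := by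
    intro a b c d ha hb hc
    rw [sum_insert ha, sum_insert hb, sum_insert hc, sum_singleton]
    ring
  rw [four _ _ _ _ (by decide) (by decide) (by decide)] at f0 f1 f2
  rw [sum_pair (by decide)] at f01 f12 f02
  rw [sum_singleton] at f012
  rw [g, hsum, h0, h1, h2, h3, h4, e0, e1, e2, e3, e4, f0, f1, f2, f01, f12, f02, f012, g4]
  ring

end LatinRect

theorem mainTheorem1 :
    -- the general formula, for `k = m + 1` rows
    (∀ m : ℕ,
      -- reduction to reduced rectangles
      (∀ n : ℕ, latinCount (m + 1) n = n ! * reducedCount (m + 1) n) ∧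
      -- inclusion-exclusion over the omitted halls of reduced lonely-hall configurations
      (∀ n : ℕ, (reducedCount (m + 1) n : ℤ) =
        ∑ S : Finset (Fin m × Fin n), (-1) ^ S.card * (omitCount S : ℤ)) ∧
      -- the numbers in the inclusion-exclusion formula depend only on the parameters
      (∀ (n : ℕ) (S : Finset (Fin m × Fin n)),
        (omitCount S : ℤ) = ∏ ε, g m (shift (param S) ε) ^ param S ε) ∧
      -- the meaning of the function `g`
      (∀ (n : ℕ) (T : Finset (Fin m × Fin n)),
        (pickCount T : ℤ) = g m (fun ε => (param T ε : ℤ))) ∧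
      -- the formula
      (∀ n : ℕ, (reducedCount (m + 1) n : ℤ) = ∑ s ∈ paramSet m n, summand (g m) s) ∧
      -- the formula as an arithmetic expression
      (∀ n : ℕ, ∀ s ∈ paramSet m n, (termExpr m n s).eval = (summand (g m) s : ℚ)) ∧
      (∀ n : ℕ, (formulaExpr m n).eval = (reducedCount (m + 1) n : ℚ)) ∧
      -- its number of terms
      ((fun n : ℕ => ((paramSet m n).card : ℝ)) =Θ[atTop]
        fun n : ℕ => (n : ℝ) ^ (2 ^ m - 1)) ∧
      -- the number of operations in each term
      (∃ C : ℕ, ∀ n : ℕ, ∀ s ∈ paramSet m n,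
        (termExpr m n s).adds ≤ C ∧
          n ≤ (termExpr m n s).muls ∧ (termExpr m n s).muls ≤ C * (n + 1)) ∧
      -- the number of operations in the whole expression
      ((fun n : ℕ => ((formulaExpr m n).cost : ℝ)) =Θ[atTop]
        fun n : ℕ => (n : ℝ) ^ (2 ^ m))) ∧
    -- the instance `k = 4`
    (∀ t : Idx 3 → ℤ, g 3 t = g4 t) ∧
    (∀ n : ℕ, (reducedCount 4 n : ℤ) = ∑ s ∈ paramSet 3 n, summand g4 s) := by
  refine ⟨fun m => ⟨latinCount_eq_factorial_mul m, reducedCount_eq_sum_omitCount m,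
    fun _ => omitCount_eq_prod_g, fun _ => pickCount_eq_g, reducedCount_eq_sum_summand m,
    fun _ _ => eval_termExpr, eval_formulaExpr m, isTheta_card_paramSet m,
    exists_adds_muls_termExpr_bound m, isTheta_cost_formulaExpr m⟩, g_three_eq_g4, fun n => ?_⟩
  rw [← funext g_three_eq_g4]
  exact reducedCount_eq_sum_summand 3 n
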